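/- Let $r\in\{1,2,\dots,\infty\}$, let $M\subset\mathbb R^N$ be a compact embedded $C^r$ submanifold (all of one dimension $\dim M$), and let $T:M\to M$ be a $C^r$ diffeomorphism. Let $X\subset M$ be a compact set and let $\mu$ be a Borel probability measure on $X$. Fix $k\in\mathbb N$ and assume that $$\mu\Big(\bigcup_{j=1}^{k-1}\operatorname{Per}_j(T)\Big)=0,\qquad \operatorname{Per}_j(T)=\{x\in M: T^jx=x\}.$$ Let $h_1,\dots,h_m:\mathbb R^N\to\mathbb R$ be a basis of the linear space of real polynomials in $N$ variables of degree at most $2k-1$, and let $h:M\to\mathbb R$ be a $C^r$ function. For $\alpha\in\mathbb R^m$ put $h_\alpha=h+\sum_{j=1}^m\alpha_jh_j$ and let $$\phi_\alpha=\phi_{h_\alpha,k}:M\to\mathbb R^k,\qquad \phi_\alpha(x)=\big(h_\alpha(x),h_\alpha(Tx),\dots,h_\alpha(T^{k-1}x)\big)$$ be the $k$-delay coordinate map of $h_\alpha$. Let $\|\cdot\|$ denote the Euclidean norm and $\mathcal H^k$ the $k$-dimensional Hausdorff measure. Then for Lebesgue almost every $\alpha\in\mathbb R^m$ the following hold. 1.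 If $\mathcal H^k(X)=0$ and $k\ge\dim M$, then for $\mu$-a.e. $x$ there exists $C=C(x,\alpha)\in[0,\infty)$ such that $\|x-y\|\le C\,\|\phi_\alpha(x)-\phi_\alpha(y)\|$ for every $y\in X$. 2. If $k>\dim M$, then for $\mu$-a.e. $x$ there exist open neighbourhoods $U$ of $x$ in $M$ and $V$ of $\phi_\alpha(x)$ in $\mathbb R^k$ such that $U=\{y\in M:\phi_\alpha(y)\in V\}$, the set $V\cap\phi_\alpha(M)$ is an embedded $C^r$ submanifold of $\mathbb R^k$ of dimension $\dim M$, and $\phi_\alpha$ restricts to a $C^r$ diffeomorphism from $U$ onto $V\cap\phi_\alpha(M)$. -/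

import Mathlib

open MeasureTheory

namespace Takens

/-- A map `f` is of class `C^r` on an arbitrary subset `A` of a Euclidean space if near every point
of `A` it agrees on `A` with a `C^r` map defined on an open set of the ambient space.
Only the values of `f` on `A` matter.  For `A` an embedded `C^r` submanifold these are the `C^r` maps
on the manifold `A`. -/
def IsCrOn (r : ℕ∞) {p q : ℕ}
    (f : EuclideanSpace ℝ (Fin p) → EuclideanSpace ℝ (Fin q))
    (A : Set (EuclideanSpace ℝ (Fin p))) : Prop :=
  ∀ x ∈ A, ∃ (O : Set (EuclideanSpace ℝ (Fin p)))
      (F : EuclideanSpace ℝ (Fin p) → EuclideanSpace ℝ (Fin q)),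
    IsOpen O ∧ x ∈ O ∧ ContDiffOn ℝ r F O ∧ Set.EqOn f F (A ∩ O)

/-- The same notion for real-valued functions. -/
def IsCrFunOn (r : ℕ∞) {p : ℕ} (f : EuclideanSpace ℝ (Fin p) → ℝ)
    (A : Set (EuclideanSpace ℝ (Fin p))) : Prop :=
  ∀ x ∈ A, ∃ (O : Set (EuclideanSpace ℝ (Fin p))) (F : EuclideanSpace ℝ (Fin p) → ℝ),
    IsOpen O ∧ x ∈ O ∧ ContDiffOn ℝ r F O ∧ Set.EqOn f F (A ∩ O)

/-- `f` restricts to a `C^r` diffeomorphism from `A` onto `B`: it is a bijection `A → B`, of class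
`C^r` on `A`, and the inverse map `g : B → A` is of class `C^r` on `B`. -/
def IsCrDiffeo (r : ℕ∞) {p q : ℕ}
    (f : EuclideanSpace ℝ (Fin p) → EuclideanSpace ℝ (Fin q))
    (A : Set (EuclideanSpace ℝ (Fin p))) (B : Set (EuclideanSpace ℝ (Fin q))) : Prop :=
  Set.BijOn f A B ∧ IsCrOn r f A ∧
    ∃ g : EuclideanSpace ℝ (Fin q) → EuclideanSpace ℝ (Fin p),
      Set.InvOn g f A B ∧ IsCrOn r g B

/-- `M` is an embedded `C^r` submanifold of dimension `d` of `ℝ^N` (for `1 ≤ r`): every point of `M`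
has an open neighbourhood `O` in `ℝ^N` such that `M ∩ O` is the image of an open set `W ⊆ ℝ^d` under
a `C^r` immersion that is a homeomorphism of `W` onto `M ∩ O` (a local parametrization). -/
def IsEmbeddedSubmanifold (r : ℕ∞) (d : ℕ) {N : ℕ}
    (M : Set (EuclideanSpace ℝ (Fin N))) : Prop :=
  ∀ x ∈ M, ∃ (O : Set (EuclideanSpace ℝ (Fin N))) (W : Set (EuclideanSpace ℝ (Fin d)))
      (ψ : EuclideanSpace ℝ (Fin d) → EuclideanSpace ℝ (Fin N)),
    IsOpen O ∧ x ∈ O ∧ IsOpen W ∧ ContDiffOn ℝ r ψ W ∧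
      (∀ u ∈ W, Function.Injective (fderiv ℝ ψ u)) ∧
      Topology.IsEmbedding (W.domRestrict ψ) ∧ ψ '' W = M ∩ O

/-- The `k`-delay coordinate map `x ↦ (h x, h (T x), …, h (T^(k-1) x))`. -/
noncomputable def delayMap {N : ℕ} (T : EuclideanSpace ℝ (Fin N) → EuclideanSpace ℝ (Fin N))
    (h : EuclideanSpace ℝ (Fin N) → ℝ) (k : ℕ) (x : EuclideanSpace ℝ (Fin N)) :
    EuclideanSpace ℝ (Fin k) :=
  WithLp.toLp 2 fun i : Fin k => h (T^[(i : ℕ)] x)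

/-- The perturbed observable `h_α = h + ∑ j, α j • P j`, for polynomials `P j` in `N` variables. -/
noncomputable def perturbedObservable {N m : ℕ} (h : EuclideanSpace ℝ (Fin N) → ℝ)
    (P : Fin m → MvPolynomial (Fin N) ℝ) (α : Fin m → ℝ) (x : EuclideanSpace ℝ (Fin N)) : ℝ :=
  h x + ∑ j, α j * MvPolynomial.eval (fun i => x i) (P j)

end Takens

/-!
Write `φ_α(x) - φ_α(y) = a(y) + B(y) α`, where `a` comes from the unperturbed observable and the
`k × m` matrix `B(y)` from the values of the polynomials along the orbit segments of `x` and `y`.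
Both claims follow from one estimate: for almost every `α` and `μ`-almost every `x ∈ X` there is `C`
with `‖x - y‖ ≤ C ‖φ_α(x) - φ_α(y)‖` for all `y ∈ X` (`ae_ae_exists_norm_sub_le`).  The set of pairs
`(α, x)` for which this holds is an `F_σ`, so by Fubini it suffices to fix a point `x` for which
`x, T x, …, T^(k-1) x` are distinct, and to find the estimate for almost every `α`.  By compactness
of `X` it splits into two parts.

* Separation (`ae_forall_eq_of_delayMap_eq`).  If the orbit segment of `y₀` does not meet that of `x`,
  interpolation at `2k` points shows that `B(y₀)` is onto.  Then a right inverse `S` of `B(y₀)` gives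
  `k` directions in parameter space along which `a(y) + B(y) (α + S t) = 0` determines `t` as a
  Lipschitz function of `y` near `y₀`; since `H^k(X) = 0`, only a null set of `t` occurs.  Countably
  many such neighbourhoods cover `X` up to finitely many points on the orbit of `x`.  For each of
  these the bad parameters satisfy a nontrivial affine equation.
* Immersion at `x` (`ae_exists_eventually_norm_sub_le`).  Polynomials of degree `2k - 1` can have
  prescribed gradients at the `k` points `T^i x`.  As `dim M ≤ k`, some parameter therefore makes the
  linear part of the derivative of the delay map on the tangent space of `M` at `x` injective, and
  then almost every parameter makes the derivative injective, by the finiteness of the spectrum.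

If `dim M < k`, then `H^k(M) = 0` and the estimate holds with `X = M`.  It says that `φ_α` is an
immersion at `x` and that no other point of `M` has the image `φ_α(x)`; the inverse function theorem
and the compactness of `M` then produce the neighbourhoods
(`exists_embedded_neighbourhood`).
-/

namespace Takens

open Filter Topology

/-! ### Maps of class `C^r` on arbitrary sets -/

section LocExt
variable {E F G : Type*} [NormedAddCommGroup E] [NormedSpace ℝ E] [NormedAddCommGroup F]
  [NormedSpace ℝ F] [NormedAddCommGroup G] [NormedSpace ℝ G]

/-- A map between normed spaces is of class `C^r` on an arbitrary set `A` if near every point of `A`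
it agrees on `A` with a `C^r` map defined on an open set.  `IsCrOn` and `IsCrFunOn` are the instances
for maps from a Euclidean space to a Euclidean space and to `ℝ`. -/
def LocExt (r : ℕ∞) (f : E → F) (A : Set E) : Prop :=
  ∀ x ∈ A, ∃ (O : Set E) (F' : E → F), IsOpen O ∧ x ∈ O ∧ ContDiffOn ℝ r F' O ∧ Set.EqOn f F' (A ∩ O)

variable {r : ℕ∞} {f : E → F} {g : F → G} {A : Set E} {B : Set F}

theorem LocExt.mono (hf : LocExt r f A) {A' : Set E} (h : A' ⊆ A) : LocExt r f A' := by
  intro x hx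
  obtain ⟨O, F', hO, hxO, hF, he⟩ := hf x (h hx)
  exact ⟨O, F', hO, hxO, hF, he.mono (Set.inter_subset_inter_left _ h)⟩

theorem LocExt.of_le (hf : LocExt r f A) {s : ℕ∞} (hs : s ≤ r) : LocExt s f A := by
  intro x hx
  obtain ⟨O, F', hO, hxO, hF, he⟩ := hf x hx
  exact ⟨O, F', hO, hxO, hF.of_le (by exact_mod_cast hs), he⟩

theorem LocExt.comp (hg : LocExt r g B) (hf : LocExt r f A) (hAB : Set.MapsTo f A B) :
    LocExt r (g ∘ f) A := by
  intro x hx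
  obtain ⟨O, F', hO, hxO, hF, he⟩ := hf x hx
  obtain ⟨O', G', hO', hxO', hG, he'⟩ := hg (f x) (hAB hx)
  refine ⟨O ∩ F' ⁻¹' O', G' ∘ F', hF.continuousOn.isOpen_inter_preimage hO hO',
    ⟨hxO, ?_⟩, hG.comp (hF.mono Set.inter_subset_left) fun y hy => hy.2, ?_⟩
  · show F' x ∈ O'
    rw [← he ⟨hx, hxO⟩]; exact hxO'
  · rintro y ⟨hy, hyO, hyO'⟩
    have h1 := he ⟨hy, hyO⟩
    have h2 : F' y ∈ O' := hyO'
    show g (f y) = G' (F' y)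
    rw [← h1] at h2 ⊢
    exact he' ⟨hAB hy, h2⟩

theorem LocExt.continuousOn (hf : LocExt r f A) : ContinuousOn f A := by
  intro x hx
  obtain ⟨O, F', hO, hxO, hF, he⟩ := hf x hx
  have h1 : ContinuousWithinAt F' A x :=
    (hF.continuousOn.continuousAt (hO.mem_nhds hxO)).continuousWithinAt
  refine h1.congr_of_eventuallyEq ?_ (he ⟨hx, hxO⟩)
  filter_upwards [self_mem_nhdsWithin, mem_nhdsWithin_of_mem_nhds (hO.mem_nhds hxO)] with y h1 h2
  exact he ⟨h1, h2⟩

theorem LocExt.id (A : Set E) : LocExt r (fun x : E => x) A := fun _ _ =>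
  ⟨Set.univ, _, isOpen_univ, trivial, contDiffOn_id, fun _ _ => rfl⟩

theorem LocExt.of_contDiff (hg : ContDiff ℝ r f) : LocExt r f A := fun _ _ =>
  ⟨Set.univ, _, isOpen_univ, trivial, hg.contDiffOn, fun _ _ => rfl⟩

theorem LocExt.of_contDiffOn (hf : ContDiffOn ℝ r f A) (hA : IsOpen A) : LocExt r f A :=
  fun _ hx => ⟨A, _, hA, hx, hf, fun _ _ => rfl⟩

theorem LocExt.pi {ι : Type*} [Fintype ι] {f : E → ι → F}
    (hf : ∀ i, LocExt r (fun x => f x i) A) : LocExt r f A := by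
  intro x hx
  choose O F' hO hxO hF he using fun i => hf i x hx
  refine ⟨⋂ i, O i, fun y i => F' i y, isOpen_iInter_of_finite hO, Set.mem_iInter.2 hxO,
    contDiffOn_pi.2 fun i => (hF i).mono (Set.iInter_subset _ _), ?_⟩
  rintro y ⟨hy, hyO⟩
  ext i
  exact he i ⟨hy, Set.mem_iInter.1 hyO i⟩

theorem LocExt.prodMk {f₂ : E → G} (hf : LocExt r f A) (hf₂ : LocExt r f₂ A) :
    LocExt r (fun x => (f x, f₂ x)) A := by
  intro x hx
  obtain ⟨O, F', hO, hxO, hF, he⟩ := hf x hx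
  obtain ⟨O₂, F₂, hO₂, hxO₂, hF₂, he₂⟩ := hf₂ x hx
  refine ⟨O ∩ O₂, fun y => (F' y, F₂ y), hO.inter hO₂, ⟨hxO, hxO₂⟩,
    (hF.mono Set.inter_subset_left).prodMk (hF₂.mono Set.inter_subset_right), ?_⟩
  rintro y ⟨hy, hy1, hy2⟩
  exact Prod.ext (he ⟨hy, hy1⟩) (he₂ ⟨hy, hy2⟩)

theorem LocExt.contDiff_comp {h : F → G} (hh : ContDiff ℝ r h) (hf : LocExt r f A) :
    LocExt r (fun x => h (f x)) A :=
  (LocExt.of_contDiff (A := Set.univ) hh).comp hf (Set.mapsTo_univ _ _)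

theorem LocExt.iterate {f : E → E} (hf : LocExt r f A) (h : Set.MapsTo f A A) (n : ℕ) :
    LocExt r f^[n] A := by
  induction n with
  | zero => exact LocExt.id A
  | succ n ih =>
    rw [Function.iterate_succ']
    exact hf.comp ih (h.iterate n)

/-- On an open set the local extensions are the map itself. -/
theorem LocExt.contDiffOn (hf : LocExt r f A) (hA : IsOpen A) : ContDiffOn ℝ r f A := by
  intro x hx
  obtain ⟨O, F', hO, hxO, hF, he⟩ := hf x hx
  have h1 : ContDiffAt ℝ r F' x := (hF x hxO).contDiffAt (hO.mem_nhds hxO)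
  refine (h1.congr_of_eventuallyEq ?_).contDiffWithinAt
  filter_upwards [(hA.inter hO).mem_nhds ⟨hx, hxO⟩] with y hy using he hy

end LocExt

/-! ### Interpolation by polynomials in several variables -/

section Polynomials
variable {N : ℕ}

theorem contDiff_eval (n : WithTop ℕ∞) (P : MvPolynomial (Fin N) ℝ) :
    ContDiff ℝ n fun x : EuclideanSpace ℝ (Fin N) => MvPolynomial.eval (fun i => x i) P := by
  induction P using MvPolynomial.induction_on with
  | C a => simpa using contDiff_const
  | add p q hp hq => simpa using hp.add hq
  | mul_X p i hp =>
    simp only [map_mul, MvPolynomial.eval_X]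
    exact hp.mul ((EuclideanSpace.proj (𝕜 := ℝ) i).contDiff)

/-- A polynomial of degree at most `#s` taking the value `1` at `p` and vanishing on `s`. -/
theorem exists_polynomial_separating (p : EuclideanSpace ℝ (Fin N))
    (s : Finset (EuclideanSpace ℝ (Fin N))) (hp : p ∉ s) :
    ∃ Q : MvPolynomial (Fin N) ℝ, Q.totalDegree ≤ s.card ∧ MvPolynomial.eval (fun i => p i) Q = 1 ∧
      ∀ q ∈ s, MvPolynomial.eval (fun i => q i) Q = 0 := by
  classical
  induction s using Finset.induction_on with
  | empty => exact ⟨1, by simp, by simp, by simp⟩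
  | insert q s hq ih =>
    obtain ⟨Q, hd, h1, h0⟩ := ih fun h => hp (Finset.mem_insert_of_mem h)
    have hne : p ≠ q := fun h => hp (h ▸ Finset.mem_insert_self _ _)
    obtain ⟨i, hi⟩ : ∃ i, p i ≠ q i := by
      by_contra! hcon
      exact hne (by ext i; exact hcon i)
    have hi' : p i - q i ≠ 0 := sub_ne_zero.2 hi
    refine ⟨MvPolynomial.C (p i - q i)⁻¹ * (MvPolynomial.X i - MvPolynomial.C (q i)) * Q, ?_, ?_, ?_⟩
    · rw [Finset.card_insert_of_notMem hq, add_comm]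
      refine (MvPolynomial.totalDegree_mul _ _).trans (add_le_add ?_ hd)
      refine (MvPolynomial.totalDegree_mul _ _).trans ?_
      rw [MvPolynomial.totalDegree_C, zero_add]
      refine (MvPolynomial.totalDegree_sub _ _).trans ?_
      simp
    · simp [h1, hi']
    · intro q' hq'
      rcases Finset.mem_insert.1 hq' with rfl | h
      · simp
      · simp [h0 q' h]

/-- Hermite interpolation of first order: the gradient is prescribed at `p` and vanishes on `s`. -/
theorem exists_polynomial_fderiv (p : EuclideanSpace ℝ (Fin N))
    (s : Finset (EuclideanSpace ℝ (Fin N))) (hp : p ∉ s) (w : EuclideanSpace ℝ (Fin N) →L[ℝ] ℝ) :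
    ∃ Q : MvPolynomial (Fin N) ℝ, Q.totalDegree ≤ 2 * s.card + 1 ∧
      HasFDerivAt (fun x : EuclideanSpace ℝ (Fin N) => MvPolynomial.eval (fun i => x i) Q) w p ∧
      ∀ q ∈ s, HasFDerivAt (fun x : EuclideanSpace ℝ (Fin N) =>
        MvPolynomial.eval (fun i => x i) Q) (0 : EuclideanSpace ℝ (Fin N) →L[ℝ] ℝ) q := by
  obtain ⟨R, hd, h1, h0⟩ := exists_polynomial_separating p s hp
  let e := EuclideanSpace.basisFun (Fin N) ℝ
  let L : MvPolynomial (Fin N) ℝ :=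
    ∑ i, MvPolynomial.C (w (e i)) * (MvPolynomial.X i - MvPolynomial.C (p i))
  have hL : ∀ x : EuclideanSpace ℝ (Fin N), MvPolynomial.eval (fun i => x i) L = w (x - p) := by
    intro x
    conv_rhs => rw [← e.sum_repr (x - p)]
    simp [L, e, mul_comm]
  have hLdeg : L.totalDegree ≤ 1 := by
    refine MvPolynomial.totalDegree_finsetSum_le fun i _ => ?_
    refine (MvPolynomial.totalDegree_mul _ _).trans ?_
    rw [MvPolynomial.totalDegree_C, zero_add]
    refine (MvPolynomial.totalDegree_sub _ _).trans ?_
    simp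
  have hfun : (fun x : EuclideanSpace ℝ (Fin N) => MvPolynomial.eval (fun i => x i) (R * R * L)) =
      fun x : EuclideanSpace ℝ (Fin N) => MvPolynomial.eval (fun i => x i) R *
        MvPolynomial.eval (fun i => x i) R * w (x - p) := by
    ext x; simp [hL]
  have hRd : ∀ x, HasFDerivAt (fun x : EuclideanSpace ℝ (Fin N) => MvPolynomial.eval (fun i => x i) R)
      (fderiv ℝ (fun x : EuclideanSpace ℝ (Fin N) => MvPolynomial.eval (fun i => x i) R) x) x :=
    fun x => ((contDiff_eval 1 R).differentiable (by simp) x).hasFDerivAt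
  have hw : ∀ x, HasFDerivAt (fun x : EuclideanSpace ℝ (Fin N) => w (x - p)) w x := fun x => by
    exact w.hasFDerivAt.comp x ((hasFDerivAt_id x).sub_const p)
  -- At `p` the factor `L` vanishes, so only its derivative counts; on `s` the square does not
  -- contribute to first order.
  refine ⟨R * R * L, ?_, ?_, fun q hq => ?_⟩
  · have a1 := MvPolynomial.totalDegree_mul (R * R) L
    have a2 := MvPolynomial.totalDegree_mul R R
    omega
  · rw [hfun]
    refine (((hRd p).mul (hRd p)).mul (hw p)).congr_fderiv ?_
    ext v
    simp [h1]
  · rw [hfun]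
    refine (((hRd q).mul (hRd q)).mul (hw q)).congr_fderiv ?_
    ext v
    simp [h0 q hq]

end Polynomials

/-! ### Null sets of parameters -/

section Null
variable {m k : ℕ}

/-- A measurable set is null if its intersection with every translate of the range of some linear map
is null in the linear coordinate on the range. -/
theorem volume_eq_zero_of_slices {V : Type*} [NormedAddCommGroup V] [NormedSpace ℝ V]
    [MeasurableSpace V] [BorelSpace V] [SecondCountableTopology V] (ν : Measure V) [SFinite ν]
    [NeZero ν] (S : V →L[ℝ] (Fin m → ℝ)) {s : Set (Fin m → ℝ)} (hs : MeasurableSet s)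
    (h : ∀ α, ν {t | α + S t ∈ s} = 0) : volume s = 0 := by
  have hmeas : MeasurableSet {x : (Fin m → ℝ) × V | x.1 + S x.2 ∉ s} :=
    (measurable_fst.add (S.measurable.comp measurable_snd) : Measurable
      fun x : (Fin m → ℝ) × V => x.1 + S x.2) hs.compl
  have h1 : ∀ᵐ α : Fin m → ℝ, ∀ᵐ t ∂ν, α + S t ∉ s := Filter.Eventually.of_forall fun α => by
    rw [ae_iff]; simpa using h α
  rw [Measure.ae_ae_comm (p := fun α t => α + S t ∉ s) hmeas] at h1
  obtain ⟨t, ht⟩ := h1.exists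
  rw [ae_iff] at ht
  simp only [not_not] at ht
  rwa [show {a | a + S t ∈ s} = (fun a => a + S t) ⁻¹' s from rfl, measure_preimage_add_right] at ht

/-- If `B y₀` is onto and `X` is `H^k`-null, then for almost every `α` the equation
`a y + B y α = 0` has no solution `y ∈ X` near `y₀`.  Along the translates of the range of a right
inverse `S` of `B y₀` the equation can be solved for the parameter, which thereby becomes a Lipschitz
function of `y`. -/
theorem exists_nhds_volume_solvable_eq_zero {E : Type*} [NormedAddCommGroup E] [NormedSpace ℝ E]
    [MeasurableSpace E] [BorelSpace E] {X : Set E} (hX : IsCompact X)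
    (hH : Measure.hausdorffMeasure (k : ℝ) X = 0) {a : E → Fin k → ℝ}
    {B : E → (Fin m → ℝ) →L[ℝ] (Fin k → ℝ)} (ha : LocExt 1 a X) (hB : LocExt 1 B X)
    {y₀ : E} (hy₀ : y₀ ∈ X) (hS : Function.Surjective (B y₀)) :
    ∃ U ∈ 𝓝 y₀, volume {α | ∃ y ∈ X ∩ U, a y + B y α = 0} = 0 := by
  obtain ⟨O, a', hO, hyO, ha', hea⟩ := ha y₀ hy₀
  obtain ⟨O', B', hO', hyO', hB', heB⟩ := hB y₀ hy₀
  obtain ⟨S₀, hS₀⟩ := (B y₀ : (Fin m → ℝ) →ₗ[ℝ] (Fin k → ℝ)).exists_rightInverse_of_surjective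
    (LinearMap.range_eq_top.2 hS)
  let S : (Fin k → ℝ) →L[ℝ] (Fin m → ℝ) := LinearMap.toContinuousLinearMap S₀
  have hBS : B' y₀ ∘L S = 1 := by
    rw [← heB ⟨hy₀, hyO'⟩]
    ext1 v
    exact LinearMap.congr_fun hS₀ v
  have ha1 : ContDiffAt ℝ 1 a' y₀ := (ha' y₀ hyO).contDiffAt (hO.mem_nhds hyO)
  have hB1 : ContDiffAt ℝ 1 B' y₀ := (hB' y₀ hyO').contDiffAt (hO'.mem_nhds hyO')
  have hBS1 : ContDiffAt ℝ 1 (fun y => B' y ∘L S) y₀ := hB1.clm_comp contDiffAt_const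
  let R : E → (Fin k → ℝ) →L[ℝ] (Fin k → ℝ) := fun y => Ring.inverse (B' y ∘L S)
  have hR1 : ContDiffAt ℝ 1 R y₀ := by
    refine ContDiffAt.comp y₀ (g := Ring.inverse) ?_ hBS1
    rw [hBS]
    exact contDiffAt_ringInverse ℝ (1 : ((Fin k → ℝ) →L[ℝ] (Fin k → ℝ))ˣ)
  have hunit : ∀ᶠ y in 𝓝 y₀, IsUnit (B' y ∘L S) := by
    refine hBS1.continuousAt.eventually (Units.isOpen.mem_nhds ?_)
    show IsUnit (B' y₀ ∘L S)
    rw [hBS]; exact isUnit_one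
  -- The solution is `t = -(R y (a' y) + (R y ∘ B' y) α)`.  Bounding the two coefficients, rather than
  -- `t` itself, gives a neighbourhood that does not depend on `α`.
  obtain ⟨K₁, t₁, ht₁, hK₁⟩ := (hR1.clm_apply ha1).exists_lipschitzOnWith
  obtain ⟨K₂, t₂, ht₂, hK₂⟩ := (hR1.clm_comp hB1).exists_lipschitzOnWith
  obtain ⟨ε, hε, hball⟩ := Metric.nhds_basis_closedBall.mem_iff.1
    (inter_mem (inter_mem (hO.mem_nhds hyO) (hO'.mem_nhds hyO')) (inter_mem hunit (inter_mem ht₁ ht₂)))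
  refine ⟨Metric.closedBall y₀ ε, Metric.closedBall_mem_nhds _ hε, ?_⟩
  set U := X ∩ Metric.closedBall y₀ ε with hU
  have hUc : IsCompact U := hX.inter_right Metric.isClosed_closedBall
  have hclosed : IsClosed {α : Fin m → ℝ | ∃ y ∈ U, a y + B y α = 0} := by
    have : CompactSpace U := isCompact_iff_compactSpace.1 hUc
    have hac : Continuous fun y : U => a y :=
      (ha.continuousOn.mono Set.inter_subset_left).domRestrict
    have hBc : Continuous fun y : U => B y :=
      (hB.continuousOn.mono Set.inter_subset_left).domRestrict
    have h1 : IsClosed {p : (Fin m → ℝ) × U | a p.2 + B p.2 p.1 = 0} :=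
      isClosed_eq ((hac.comp continuous_snd).add
        ((hBc.comp continuous_snd).clm_apply continuous_fst)) continuous_const
    have h2 := isClosedMap_fst_of_compactSpace _ h1
    convert h2 using 1
    ext α
    simp
  refine volume_eq_zero_of_slices (volume : Measure (Fin k → ℝ)) S hclosed.measurableSet fun α => ?_
  have hLip : LipschitzOnWith (K₁ + K₂ * ‖α‖₊) (fun y => R y (a' y) + (R y ∘L B' y) α) U := by
    refine LipschitzOnWith.add (hK₁.mono fun y hy => (hball hy.2).2.2.1) ?_
    refine LipschitzOnWith.of_dist_le_mul fun y hy z hz => ?_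
    have h1 := hK₂.dist_le_mul y (hball hy.2).2.2.2 z (hball hz.2).2.2.2
    rw [dist_eq_norm] at h1 ⊢
    rw [← sub_apply]
    refine (ContinuousLinearMap.le_opNorm _ _).trans ?_
    calc _ ≤ (K₂ * dist y z) * ‖α‖ := by gcongr
      _ = _ := by push_cast; ring
  have hnull : volume ((fun y => -(R y (a' y) + (R y ∘L B' y) α)) '' U) = 0 := by
    have h2 := hLip.neg.hausdorffMeasure_image_le (d := k) (by positivity)
    rw [measure_mono_null Set.inter_subset_left hH, mul_zero] at h2
    have h3 := hausdorffMeasure_pi_real (ι := Fin k)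
    rw [Fintype.card_fin] at h3
    rw [← h3]
    exact le_antisymm h2 bot_le
  refine measure_mono_null ?_ hnull
  rintro t ⟨y, hy, hyt⟩
  obtain ⟨⟨hb1, hb2⟩, hb3, -⟩ := hball hy.2
  refine ⟨y, hy, ?_⟩
  rw [hea ⟨hy.1, hb1⟩, heB ⟨hy.1, hb2⟩] at hyt
  have h4 : R y (B' y (S t)) = t := by
    have := Ring.inverse_mul_cancel _ hb3
    exact congrArg (fun L : (Fin k → ℝ) →L[ℝ] (Fin k → ℝ) => L t) this
  have h5 := congrArg (R y) hyt
  simp only [map_add, map_zero, h4] at h5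
  simp only [ContinuousLinearMap.comp_apply]
  rw [neg_eq_iff_add_eq_zero, ← h5]
  abel

/-- In an affine family of linear maps whose linear part contains an injective map, almost every
member is injective: on each line in the direction of that map only finitely many are not, by the
finiteness of the spectrum. -/
theorem ae_injective_of_affine {V F : Type*} [NormedAddCommGroup V] [NormedSpace ℝ V]
    [FiniteDimensional ℝ V] [NormedAddCommGroup F] [NormedSpace ℝ F] [FiniteDimensional ℝ F]
    (A : V →L[ℝ] F)
    (Λ : (Fin m → ℝ) →L[ℝ] V →L[ℝ] F) (α₀ : Fin m → ℝ) (h₀ : Function.Injective (Λ α₀)) :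
    ∀ᵐ α, Function.Injective (A + Λ α) := by
  obtain ⟨P₀, hP₀⟩ := (Λ α₀ : V →ₗ[ℝ] F).exists_leftInverse_of_injective (LinearMap.ker_eq_bot.2 h₀)
  let P : F →L[ℝ] V := LinearMap.toContinuousLinearMap P₀
  have hP : ∀ v, P (Λ α₀ v) = v := fun v => LinearMap.congr_fun hP₀ v
  have hclosed : IsClosed {α | (P ∘L (A + Λ α)).det = 0} :=
    isClosed_eq (ContinuousLinearMap.continuous_det.comp (by fun_prop)) continuous_const
  have hnull : volume {α | (P ∘L (A + Λ α)).det = 0} = 0 := by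
    refine volume_eq_zero_of_slices (volume : Measure ℝ) (ContinuousLinearMap.toSpanSingleton ℝ α₀)
      hclosed.measurableSet fun α => ?_
    have hfin := Module.End.finite_hasEigenvalue ((P ∘L (A + Λ α) : V →L[ℝ] V) : Module.End ℝ V)
    have hz := (hfin.preimage (f := fun t : ℝ => -t) neg_injective.injOn).measure_zero
      (volume : Measure ℝ)
    refine measure_mono_null ?_ hz
    intro t ht
    obtain ⟨v, hv, hv0⟩ := Submodule.exists_mem_ne_zero_of_ne_bot
      (LinearMap.bot_lt_ker_of_det_eq_zero ht).ne'
    refine Module.End.hasEigenvalue_of_hasEigenvector (x := v) ⟨?_, hv0⟩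
    rw [Module.End.mem_eigenspace_iff]
    have h1 : P ((A + Λ (α + t • α₀)) v) = 0 := hv
    have h2 : P ((A + Λ α) v) + t • v = 0 := by
      rw [← h1]; simp [hP, add_assoc]
    show P ((A + Λ α) v) = -t • v
    rw [neg_smul]; exact eq_neg_of_add_eq_zero_left h2
  rw [ae_iff]
  refine measure_mono_null ?_ hnull
  intro α hα
  by_contra hdet
  refine hα fun v w hvw => ?_
  exact (LinearMap.equivOfDetNeZero _ hdet).injective (congrArg P hvw)

end Null

/-! ### Lower Lipschitz bounds -/

section Deterministic
variable {V F : Type*} [NormedAddCommGroup V] [NormedSpace ℝ V] [NormedAddCommGroup F]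
  [NormedSpace ℝ F] [FiniteDimensional ℝ V]

theorem isBigO_sub_of_injective_fderiv {g : V → F} {g' : V →L[ℝ] F} {u₀ : V}
    (hg : HasFDerivAt g g' u₀) (hinj : Function.Injective g') :
    (fun u => u - u₀) =O[𝓝 u₀] fun u => g u - g u₀ := by
  obtain ⟨K, -, hK⟩ := (g' : V →ₗ[ℝ] F).exists_antilipschitzWith (LinearMap.ker_eq_bot.2 hinj)
  exact (hg.isTheta_sub (hK.isUniformInducing g'.uniformContinuous).isInducing).2

/-- A lower Lipschitz bound at a point of a compact set is a local condition together with the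
injectivity at that point. -/
theorem exists_norm_sub_le_of_eventually {E F : Type*} [NormedAddCommGroup E]
    [NormedAddCommGroup F] {X : Set E} (hX : IsCompact X) {f : E → F} (hf : ContinuousOn f X) {x : E}
    (hinj : ∀ y ∈ X, f x = f y → x = y) {C₀ : ℝ}
    (hloc : ∀ᶠ y in 𝓝[X] x, ‖x - y‖ ≤ C₀ * ‖f x - f y‖) :
    ∃ C : ℝ, 0 ≤ C ∧ ∀ y ∈ X, ‖x - y‖ ≤ C * ‖f x - f y‖ := by
  obtain ⟨O, hO, hxO, hOX⟩ := mem_nhdsWithin.1 hloc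
  have hK : IsCompact (X \ O) := hX.diff hO
  have hne : ∀ y ∈ X \ O, ‖f x - f y‖ ≠ 0 := fun y hy h => by
    rw [norm_eq_zero, sub_eq_zero] at h
    exact hy.2 (hinj y hy.1 h ▸ hxO)
  have hcont : ContinuousOn (fun y => ‖x - y‖ / ‖f x - f y‖) (X \ O) := by
    refine ContinuousOn.div (by fun_prop) ?_ hne
    exact (continuousOn_const.sub (hf.mono Set.sdiff_subset)).norm
  obtain ⟨D, hD⟩ := hK.exists_bound_of_continuousOn hcont
  refine ⟨max 0 (max C₀ D), le_max_left _ _, fun y hy => ?_⟩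
  by_cases hyO : y ∈ O
  · refine (hOX ⟨hyO, hy⟩ : ‖x - y‖ ≤ C₀ * ‖f x - f y‖).trans ?_
    gcongr
    exact (le_max_left _ _).trans (le_max_right _ _)
  · have h1 := (le_abs_self _).trans (hD y ⟨hy, hyO⟩)
    rw [div_le_iff₀ (lt_of_le_of_ne (norm_nonneg _) (hne y ⟨hy, hyO⟩).symm)] at h1
    refine h1.trans ?_
    gcongr
    exact (le_max_right _ _).trans (le_max_right _ _)

end Deterministic

/-! ### Submanifolds and local inverses -/

section Geometry

/-- The image of a smaller open set under a local parametrization is again relatively open. -/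
theorem exists_isOpen_image_eq {E F : Type*} [TopologicalSpace E] [TopologicalSpace F]
    {M O : Set F} {W W₁ : Set E} {ψ : E → F} (hO : IsOpen O)
    (hemb : IsEmbedding (W.domRestrict ψ)) (him : ψ '' W = M ∩ O) (hW₁ : IsOpen W₁) (hsub : W₁ ⊆ W) :
    ∃ O₁, IsOpen O₁ ∧ ψ '' W₁ = M ∩ O₁ := by
  obtain ⟨O₂, hO₂, hpre⟩ := hemb.isInducing.isOpen_iff.1 (hW₁.preimage continuous_subtype_val)
  have hiff : ∀ u ∈ W, ψ u ∈ O₂ ↔ u ∈ W₁ := fun u hu =>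
    Set.ext_iff.1 hpre ⟨u, hu⟩
  refine ⟨O ∩ O₂, hO.inter hO₂, ?_⟩
  ext y
  constructor
  · rintro ⟨u, hu, rfl⟩
    have h1 : ψ u ∈ M ∩ O := him ▸ Set.mem_image_of_mem ψ (hsub hu)
    exact ⟨h1.1, h1.2, (hiff u (hsub hu)).2 hu⟩
  · rintro ⟨hyM, hyO, hyO₂⟩
    obtain ⟨u, hu, rfl⟩ : y ∈ ψ '' W := him ▸ ⟨hyM, hyO⟩
    exact ⟨u, (hiff u hu).1 hyO₂, rfl⟩

theorem one_le_coe {r : ℕ∞} (hr : 1 ≤ r) : (1 : WithTop ℕ∞) ≤ (r : WithTop ℕ∞) := by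
  exact_mod_cast hr

theorem IsEmbeddedSubmanifold.hausdorffMeasure_eq_zero {r : ℕ∞} (hr : 1 ≤ r) {d N k : ℕ}
    {M : Set (EuclideanSpace ℝ (Fin N))} (hM : IsEmbeddedSubmanifold r d M) (hdk : d < k) :
    Measure.hausdorffMeasure (k : ℝ) M = 0 := by
  have hdim : dimH M ≤ d := by
    by_contra! hlt
    obtain ⟨x, hx, ht⟩ := exists_mem_nhdsWithin_lt_dimH_of_lt_dimH hlt
    obtain ⟨O, W, ψ, hO, hxO, hW, hψ, -, -, him⟩ := hM x hx
    have h1 := ht (ψ '' W) (him ▸ inter_mem_nhdsWithin M (hO.mem_nhds hxO))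
    have h2 : dimH (ψ '' W) ≤ dimH W := by
      refine dimH_image_le_of_locally_lipschitzOn fun u hu => ?_
      obtain ⟨K, t, ht, hK⟩ := (((hψ u hu).contDiffAt (hW.mem_nhds hu)).of_le
        (one_le_coe hr)).exists_lipschitzOnWith
      exact ⟨K, t, mem_nhdsWithin_of_mem_nhds ht, hK⟩
    have h3 : dimH W ≤ d := by
      refine (dimH_mono (Set.subset_univ W)).trans ?_
      rw [Real.dimH_univ_eq_finrank]; simp
    exact absurd (h1.trans_le (h2.trans h3)) (lt_irrefl _)
  have h4 : dimH M < ((k : NNReal) : ENNReal) := hdim.trans_lt (by exact_mod_cast hdk)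
  exact_mod_cast hausdorffMeasure_of_dimH_lt h4

/-- An immersion at a point has a `C^r` left inverse near that point, defined on an open set of the
target.  It is obtained from the inverse function theorem for `A ∘ g`, with `A` a left inverse of the
derivative. -/
theorem exists_contDiffOn_leftInverse {V F : Type*} [NormedAddCommGroup V] [NormedSpace ℝ V]
    [FiniteDimensional ℝ V] [NormedAddCommGroup F] [NormedSpace ℝ F] [FiniteDimensional ℝ F]
    {r : ℕ∞} (hr : 1 ≤ r) {W : Set V} (hW : IsOpen W) {g : V → F} (hg : ContDiffOn ℝ r g W) {u₀ : V}
    (hu₀ : u₀ ∈ W) (hinj : Function.Injective (fderiv ℝ g u₀)) :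
    ∃ (W₁ : Set V) (Y : Set F) (L : F → V), IsOpen W₁ ∧ W₁ ⊆ W ∧ u₀ ∈ W₁ ∧ IsOpen Y ∧
      ContDiffOn ℝ r L Y ∧ ∀ u ∈ W₁, g u ∈ Y ∧ L (g u) = u := by
  have hr' := one_le_coe hr
  have hr0 : (r : WithTop ℕ∞) ≠ 0 := fun h => by simp [h] at hr'
  obtain ⟨A₀, hA₀⟩ := (fderiv ℝ g u₀ : V →ₗ[ℝ] F).exists_leftInverse_of_injective
    (LinearMap.ker_eq_bot.2 hinj)
  let A : F →L[ℝ] V := LinearMap.toContinuousLinearMap A₀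
  let f : V → V := fun u => A (g u)
  have hf : ContDiffOn ℝ r f W := A.contDiff.comp_contDiffOn hg
  have hfat : ∀ u ∈ W, ContDiffAt ℝ r f u := fun u hu => (hf u hu).contDiffAt (hW.mem_nhds hu)
  have hfd : ∀ u ∈ W, HasFDerivAt f (fderiv ℝ f u) u := fun u hu =>
    ((hfat u hu).differentiableAt hr0).hasFDerivAt
  have hf0 : fderiv ℝ f u₀ = 1 := by
    have h1 : HasFDerivAt f (A ∘L fderiv ℝ g u₀) u₀ := A.hasFDerivAt.comp u₀
      (((hg u₀ hu₀).contDiffAt (hW.mem_nhds hu₀)).differentiableAt hr0).hasFDerivAt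
    rw [h1.fderiv]
    ext1 v
    exact LinearMap.congr_fun hA₀ v
  have hcont : ContinuousOn (fderiv ℝ f) W := hf.continuousOn_fderiv_of_isOpen hW hr'
  -- For `r = ∞` the inverse is smooth on an open set, and not just to each finite order near a point,
  -- because the derivative of `f` is invertible at every point of `W'`.
  let W' : Set V := W ∩ fderiv ℝ f ⁻¹' {T | IsUnit T}
  have hW' : IsOpen W' := hcont.isOpen_inter_preimage hW Units.isOpen
  have huW' : u₀ ∈ W' := ⟨hu₀, by show IsUnit _; rw [hf0]; exact isUnit_one⟩
  have hderiv0 : HasFDerivAt f (ContinuousLinearEquiv.refl ℝ V : V →L[ℝ] V) u₀ :=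
    (hfd u₀ hu₀).congr_fderiv hf0
  let e := (hfat u₀ hu₀).toOpenPartialHomeomorph f hderiv0 hr0
  have heu : u₀ ∈ e.source := (hfat u₀ hu₀).mem_toOpenPartialHomeomorph_source hderiv0 hr0
  refine ⟨e.source ∩ W', A ⁻¹' (e.target ∩ e.symm ⁻¹' W'), fun y => e.symm (A y),
    e.open_source.inter hW', fun u hu => hu.2.1, ⟨heu, huW'⟩,
    (e.isOpen_inter_preimage_symm hW').preimage A.continuous, ?_, ?_⟩
  · intro y hy
    have hyW : e.symm (A y) ∈ W' := hy.2
    obtain ⟨T, hT⟩ : IsUnit (fderiv ℝ f (e.symm (A y))) := hyW.2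
    have h1 : HasFDerivAt e ((ContinuousLinearEquiv.unitsEquiv ℝ V T : V ≃L[ℝ] V) : V →L[ℝ] V)
        (e.symm (A y)) := by
      refine (hfd _ hyW.1).congr_fderiv ?_
      rw [← hT]; rfl
    have h2 : ContDiffAt ℝ r e.symm (A y) := e.contDiffAt_symm hy.1 h1 (hfat _ hyW.1)
    exact (h2.comp y A.contDiff.contDiffAt).contDiffWithinAt
  · rintro u ⟨hue, huW⟩
    have h1 : e.symm (A (g u)) = u := e.left_inv hue
    refine ⟨⟨e.map_source hue, ?_⟩, h1⟩
    show e.symm (A (g u)) ∈ W'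
    rw [h1]; exact huW

/-- A lower Lipschitz bound relative to a compact submanifold at a point makes a `C^r` map an
embedding over a neighbourhood of the image of that point. -/
theorem exists_embedded_neighbourhood {r : ℕ∞} (hr : 1 ≤ r) {N d k : ℕ}
    {M : Set (EuclideanSpace ℝ (Fin N))} (hMc : IsCompact M) (hM : IsEmbeddedSubmanifold r d M)
    {f : EuclideanSpace ℝ (Fin N) → EuclideanSpace ℝ (Fin k)} (hf : LocExt r f M)
    {x : EuclideanSpace ℝ (Fin N)} (hx : x ∈ M) {C : ℝ}
    (hC : ∀ y ∈ M, ‖x - y‖ ≤ C * ‖f x - f y‖) :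
    ∃ (U : Set (EuclideanSpace ℝ (Fin N))) (V : Set (EuclideanSpace ℝ (Fin k))),
      (∃ O : Set (EuclideanSpace ℝ (Fin N)), IsOpen O ∧ U = M ∩ O) ∧ x ∈ U ∧
      IsOpen V ∧ f x ∈ V ∧ U = M ∩ f ⁻¹' V ∧
      IsEmbeddedSubmanifold r d (V ∩ f '' M) ∧ IsCrDiffeo r f U (V ∩ f '' M) := by
  have hr0 : (r : WithTop ℕ∞) ≠ 0 := fun h => by simpa [h] using one_le_coe hr
  obtain ⟨O, W, ψ, hO, hxO, hW, hψ, hψinj, hemb, him⟩ := hM x hx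
  obtain ⟨u₀, hu₀, rfl⟩ : x ∈ ψ '' W := him ▸ ⟨hx, hxO⟩
  have hmaps : Set.MapsTo ψ W M := fun u hu =>
    ((him ▸ Set.mem_image_of_mem ψ hu : ψ u ∈ M ∩ O)).1
  let g := f ∘ ψ
  have hg : ContDiffOn ℝ r g W := (hf.comp (LocExt.of_contDiffOn hψ hW) hmaps).contDiffOn hW
  have hgd : ∀ u ∈ W, HasFDerivAt g (fderiv ℝ g u) u := fun u hu =>
    (((hg u hu).contDiffAt (hW.mem_nhds hu)).differentiableAt hr0).hasFDerivAt
  have hψd : ∀ u ∈ W, HasFDerivAt ψ (fderiv ℝ ψ u) u := fun u hu =>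
    (((hψ u hu).contDiffAt (hW.mem_nhds hu)).differentiableAt hr0).hasFDerivAt
  have hginj : Function.Injective (fderiv ℝ g u₀) := by
    rw [injective_iff_map_eq_zero]
    intro v hv
    have h1 : HasDerivAt (fun t : ℝ => u₀ + t • v) v 0 := by
      simpa using ((hasDerivAt_id (0 : ℝ)).smul_const v).const_add u₀
    have h2 : HasDerivAt (fun t : ℝ => g (u₀ + t • v)) 0 0 := by
      have := (show HasFDerivAt g (fderiv ℝ g u₀) (u₀ + (0 : ℝ) • v) by
        simpa using hgd u₀ hu₀).comp_hasDerivAt 0 h1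
      rwa [hv] at this
    have h3 : HasDerivAt (fun t : ℝ => ψ (u₀ + t • v)) (fderiv ℝ ψ u₀ v) 0 :=
      (show HasFDerivAt ψ (fderiv ℝ ψ u₀) (u₀ + (0 : ℝ) • v) by
        simpa using hψd u₀ hu₀).comp_hasDerivAt 0 h1
    have h4 : HasDerivAt (fun t : ℝ => ψ (u₀ + t • v)) 0 0 := by
      rw [hasDerivAt_iff_isLittleO] at h2 ⊢
      -- The hypothesis bounds the increment of `ψ` by that of `g`, which is `o(t)`.
      refine Asymptotics.IsBigO.trans_isLittleO (Asymptotics.IsBigO.of_bound C ?_) h2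
      have h5 : ∀ᶠ t : ℝ in 𝓝 0, u₀ + t • v ∈ W := by
        refine h1.continuousAt.eventually (hW.mem_nhds ?_)
        simpa using hu₀
      filter_upwards [h5] with t ht
      have := hC _ (hmaps ht)
      simpa [g, norm_sub_rev] using this
    exact (injective_iff_map_eq_zero _).1 (hψinj u₀ hu₀) v (h3.unique h4)
  obtain ⟨W₁, Y, L, hW₁, hW₁W, hu₁, hY, hL, hLg⟩ := exists_contDiffOn_leftInverse hr hW hg hu₀ hginj
  obtain ⟨O₁, hO₁, him₁⟩ := exists_isOpen_image_eq hO hemb him hW₁ hW₁W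
  have hfc := hf.continuousOn
  have hKc : IsCompact (f '' (M \ O₁)) := (hMc.diff hO₁).image_of_continuousOn
    (hfc.mono Set.sdiff_subset)
  have hxO₁ : ψ u₀ ∈ M ∩ O₁ := him₁ ▸ Set.mem_image_of_mem ψ hu₁
  -- Points of `M` outside the chart have images away from that of `ψ u₀`.
  let V := (f '' (M \ O₁))ᶜ
  have hV : IsOpen V := hKc.isClosed.isOpen_compl
  have hxV : f (ψ u₀) ∈ V := by
    rintro ⟨y, hy, hfy⟩
    have h1 := hC y hy.1
    rw [hfy, sub_self, norm_zero, mul_zero] at h1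
    have h2 : ψ u₀ = y := sub_eq_zero.1 (norm_le_zero_iff.1 h1)
    exact hy.2 (h2 ▸ hxO₁.2)
  let W₂ := W₁ ∩ g ⁻¹' V
  have hW₂ : IsOpen W₂ := (hg.continuousOn.mono hW₁W).isOpen_inter_preimage hW₁ hV
  have hUW : M ∩ f ⁻¹' V = ψ '' W₂ := by
    ext y
    constructor
    · rintro ⟨hyM, hyV⟩
      have hyO : y ∈ O₁ := by
        by_contra hcon
        exact hyV ⟨y, ⟨hyM, hcon⟩, rfl⟩
      obtain ⟨u, hu, rfl⟩ : y ∈ ψ '' W₁ := him₁ ▸ ⟨hyM, hyO⟩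
      exact ⟨u, ⟨hu, hyV⟩, rfl⟩
    · rintro ⟨u, hu, rfl⟩
      exact ⟨hmaps (hW₁W hu.1), hu.2⟩
  have himg : V ∩ f '' M = g '' W₂ := by
    rw [show g '' W₂ = f '' (ψ '' W₂) from Set.image_comp f ψ W₂, ← hUW, Set.inter_comm V,
      Set.image_inter_preimage]
  refine ⟨M ∩ f ⁻¹' V, V, ?_, ⟨hx, hxV⟩, hV, hxV, rfl, ?_, ?_, hf.mono Set.inter_subset_left,
    fun y => ψ (L y), ?_, ?_⟩
  · obtain ⟨O₃, hO₃, h3⟩ := continuousOn_iff'.1 hfc V hV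
    exact ⟨O₃, hO₃, by rw [Set.inter_comm, h3, Set.inter_comm]⟩
  · intro y hy
    refine ⟨V, W₂, g, hV, hy.1, hW₂, hg.mono fun u hu => hW₁W hu.1, fun u hu => ?_, ?_, ?_⟩
    · obtain ⟨hgY, -⟩ := hLg u hu.1
      have h1 : HasFDerivAt L (fderiv ℝ L (g u)) (g u) :=
        (((hL _ hgY).contDiffAt (hY.mem_nhds hgY)).differentiableAt hr0).hasFDerivAt
      have h2 := h1.comp u (hgd u (hW₁W hu.1))
      have h3 : HasFDerivAt (L ∘ g) (ContinuousLinearMap.id ℝ _) u :=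
        (hasFDerivAt_id u).congr_of_eventuallyEq
          (by filter_upwards [hW₁.mem_nhds hu.1] with w hw using (hLg w hw).2)
      have h4 := h2.unique h3
      exact Function.LeftInverse.injective (g := fderiv ℝ L (g u)) fun v =>
        congrArg (fun T : EuclideanSpace ℝ (Fin d) →L[ℝ] EuclideanSpace ℝ (Fin d) => T v) h4
    · have hgc : Continuous (W₂.domRestrict g) :=
        (hg.continuousOn.mono fun u hu => hW₁W hu.1).domRestrict
      have h1 : IsEmbedding (fun u : W₂ => (⟨g u, (hLg u u.2.1).1⟩ : Y)) := by
        refine IsEmbedding.of_comp (g := Y.domRestrict L) (hgc.subtype_mk _)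
          hL.continuousOn.domRestrict ?_
        convert IsEmbedding.subtypeVal (p := fun u => u ∈ W₂) using 1
        ext1 u
        exact (hLg u u.2.1).2
      exact IsEmbedding.subtypeVal.comp h1
    · rw [himg, Set.inter_eq_left.2]
      rintro _ ⟨u, hu, rfl⟩
      exact hu.2
  · rw [himg, hUW]
    refine ⟨?_, ?_, ?_⟩
    · rintro _ ⟨u, hu, rfl⟩
      exact ⟨u, hu, rfl⟩
    · rintro _ ⟨u, hu, rfl⟩ _ ⟨w, hw, rfl⟩ huw
      have h1 := congrArg L (show g u = g w from huw)
      rw [(hLg u hu.1).2, (hLg w hw.1).2] at h1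
      rw [h1]
    · rintro _ ⟨u, hu, rfl⟩
      exact ⟨ψ u, ⟨u, hu, rfl⟩, rfl⟩
  · rw [himg, hUW]
    constructor
    · rintro _ ⟨u, hu, rfl⟩
      exact congrArg ψ (hLg u hu.1).2
    · rintro _ ⟨u, hu, rfl⟩
      exact congrArg g (hLg u hu.1).2
  · rw [himg]
    rintro _ ⟨u, hu, rfl⟩
    obtain ⟨hgY, hgL⟩ := hLg u hu.1
    refine ⟨Y ∩ L ⁻¹' W, fun y => ψ (L y), hL.continuousOn.isOpen_inter_preimage hY hW,
      ⟨hgY, ?_⟩, hψ.comp (hL.mono Set.inter_subset_left) fun y hy => hy.2, fun _ _ => rfl⟩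
    show L (g u) ∈ W
    rw [hgL]; exact hW₁W hu.1

end Geometry

/-! ### The delay map near a given point, for almost every parameter -/

section Dynamics
variable {N m k : ℕ}

/-- The part of the delay map of a perturbed observable that is linear in the parameter `α`:
its `i`-th coordinate is `∑ j, α j * P j (T^i y)`. -/
noncomputable def delayLinear (T : EuclideanSpace ℝ (Fin N) → EuclideanSpace ℝ (Fin N))
    (P : Fin m → MvPolynomial (Fin N) ℝ) (k : ℕ) (y : EuclideanSpace ℝ (Fin N)) :
    (Fin m → ℝ) →L[ℝ] (Fin k → ℝ) :=
  ContinuousLinearMap.pi fun i => ∑ j,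
    MvPolynomial.eval (fun l => (T^[(i : ℕ)] y) l) (P j) • ContinuousLinearMap.proj (R := ℝ) j

variable {T : EuclideanSpace ℝ (Fin N) → EuclideanSpace ℝ (Fin N)}
  {P : Fin m → MvPolynomial (Fin N) ℝ} {h : EuclideanSpace ℝ (Fin N) → ℝ}

theorem delayLinear_apply (y : EuclideanSpace ℝ (Fin N)) (α : Fin m → ℝ) (i : Fin k) :
    delayLinear T P k y α i =
      ∑ j, α j * MvPolynomial.eval (fun l => (T^[(i : ℕ)] y) l) (P j) := by
  simp [delayLinear, mul_comm]

theorem delayMap_perturbedObservable (y : EuclideanSpace ℝ (Fin N)) (α : Fin m → ℝ) :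
    delayMap T (perturbedObservable h P α) k y =
      WithLp.toLp 2 ((fun i : Fin k => h (T^[(i : ℕ)] y)) + delayLinear T P k y α) := by
  ext i
  simp [delayMap, perturbedObservable, delayLinear_apply]

theorem norm_le_norm_toLp (v : Fin k → ℝ) : ‖v‖ ≤ ‖(WithLp.toLp 2 v : EuclideanSpace ℝ (Fin k))‖ :=
  (pi_norm_le_iff_of_nonneg (norm_nonneg _)).2 fun i =>
    PiLp.norm_apply_le (WithLp.toLp 2 v : EuclideanSpace ℝ (Fin k)) i

variable {r : ℕ∞} {M : Set (EuclideanSpace ℝ (Fin N))}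

theorem locExt_observable_iterate (hT : LocExt r T M) (hTM : Set.MapsTo T M M) (hh : LocExt r h M) :
    LocExt r (fun y => fun i : Fin k => h (T^[(i : ℕ)] y)) M :=
  LocExt.pi fun i => hh.comp (hT.iterate hTM i) (hTM.iterate i)

theorem locExt_delayLinear (hT : LocExt r T M) (hTM : Set.MapsTo T M M) :
    LocExt r (delayLinear T P k) M := by
  have h1 : LocExt r (fun y => fun (i : Fin k) (j : Fin m) =>
      MvPolynomial.eval (fun l => (T^[(i : ℕ)] y) l) (P j)) M :=
    LocExt.pi fun i => LocExt.pi fun j =>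
      (LocExt.of_contDiff (A := Set.univ) (contDiff_eval r (P j))).comp (hT.iterate hTM i)
        (Set.mapsTo_univ _ _)
  refine LocExt.contDiff_comp (h := fun c : Fin k → Fin m → ℝ => (ContinuousLinearMap.pi fun i =>
    ∑ j, c i j • ContinuousLinearMap.proj (R := ℝ) j : (Fin m → ℝ) →L[ℝ] (Fin k → ℝ))) ?_ h1
  rw [contDiff_clm_apply_iff]
  intro α
  rw [contDiff_pi]
  intro i
  simp only [ContinuousLinearMap.pi_apply, sum_apply, smul_apply, ContinuousLinearMap.proj_apply]
  fun_prop

theorem iterate_leftInvOn {E : Type*} {T S : E → E} {M : Set E} (hTM : Set.MapsTo T M M)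
    (hST : Set.LeftInvOn S T M) (n : ℕ) : Set.LeftInvOn S^[n] T^[n] M := by
  induction n with
  | zero => exact fun _ _ => rfl
  | succ n ih =>
    intro y hy
    rw [Function.iterate_succ_apply' T, Function.iterate_succ_apply S, hST (hTM.iterate n hy), ih hy]

theorem exists_coeff {D : ℕ}
    (b : Module.Basis (Fin m) ℝ (MvPolynomial.restrictTotalDegree (Fin N) ℝ D))
    (Q : MvPolynomial (Fin N) ℝ) (hQ : Q.totalDegree ≤ D) :
    ∃ α : Fin m → ℝ, ∀ p : Fin N → ℝ,
      ∑ j, α j * MvPolynomial.eval p (b j : MvPolynomial (Fin N) ℝ) = MvPolynomial.eval p Q := by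
  let q : MvPolynomial.restrictTotalDegree (Fin N) ℝ D :=
    ⟨Q, (MvPolynomial.mem_restrictTotalDegree _ _ _).2 hQ⟩
  refine ⟨b.repr q, fun p => ?_⟩
  have h1 := congrArg (fun z : MvPolynomial.restrictTotalDegree (Fin N) ℝ D =>
    MvPolynomial.eval p (z : MvPolynomial (Fin N) ℝ)) (b.sum_repr q)
  simp only [Submodule.coe_sum, Submodule.coe_smul, map_sum, MvPolynomial.smul_eval] at h1
  exact h1

section FixedPoint

variable (b : Module.Basis (Fin m) ℝ (MvPolynomial.restrictTotalDegree (Fin N) ℝ (2 * k - 1)))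

/-- Interpolation at the at most `2k` points of the two orbit segments. -/
theorem surjective_delayLinear_sub {x y : EuclideanSpace ℝ (Fin N)}
    (hx : Function.Injective fun i : Fin k => T^[(i : ℕ)] x)
    (hxy : ∀ i j : Fin k, T^[(i : ℕ)] x ≠ T^[(j : ℕ)] y) :
    Function.Surjective (delayLinear T (fun j => (b j : MvPolynomial (Fin N) ℝ)) k x -
      delayLinear T (fun j => (b j : MvPolynomial (Fin N) ℝ)) k y) := by
  classical
  have hQ : ∀ i : Fin k, ∃ Q : MvPolynomial (Fin N) ℝ, Q.totalDegree ≤ 2 * k - 1 ∧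
      (∀ l : Fin k, MvPolynomial.eval (fun n => (T^[(l : ℕ)] x) n) Q = if l = i then 1 else 0) ∧
      ∀ l : Fin k, MvPolynomial.eval (fun n => (T^[(l : ℕ)] y) n) Q = 0 := by
    intro i
    obtain ⟨Q, hd, h1, h0⟩ := exists_polynomial_separating (T^[(i : ℕ)] x)
      ((Finset.univ.erase i).image (fun l : Fin k => T^[(l : ℕ)] x) ∪
        Finset.univ.image (fun l : Fin k => T^[(l : ℕ)] y)) (by
        simp only [Finset.mem_union, Finset.mem_image, Finset.mem_erase, Finset.mem_univ, and_true,
          true_and, not_or, not_exists, not_and]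
        exact ⟨fun l hl hli => hl (hx hli), fun l hl => hxy i l hl.symm⟩)
    refine ⟨Q, hd.trans ?_, fun l => ?_, fun l => h0 _ ?_⟩
    · have c1 := Finset.card_union_le ((Finset.univ.erase i).image (fun l : Fin k => T^[(l : ℕ)] x))
        (Finset.univ.image (fun l : Fin k => T^[(l : ℕ)] y))
      have c2 := Finset.card_image_le (s := Finset.univ.erase i) (f := fun l : Fin k => T^[(l : ℕ)] x)
      have c3 := Finset.card_image_le (s := Finset.univ) (f := fun l : Fin k => T^[(l : ℕ)] y)
      rw [Finset.card_erase_of_mem (Finset.mem_univ i), Finset.card_univ, Fintype.card_fin] at c2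
      rw [Finset.card_univ, Fintype.card_fin] at c3
      have := i.pos
      omega
    · split_ifs with hl
      · rw [hl, h1]
      · exact h0 _ (Finset.mem_union_left _ (Finset.mem_image_of_mem _
          (Finset.mem_erase.2 ⟨hl, Finset.mem_univ _⟩)))
    · exact Finset.mem_union_right _ (Finset.mem_image_of_mem (fun l : Fin k => T^[(l : ℕ)] y)
        (Finset.mem_univ l))
  choose Q hd hQx hQy using hQ
  intro c
  obtain ⟨α, hα⟩ := exists_coeff b (∑ i, MvPolynomial.C (c i) * Q i)
    (MvPolynomial.totalDegree_finsetSum_le fun i _ => by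
      refine (MvPolynomial.totalDegree_mul _ _).trans ?_
      rw [MvPolynomial.totalDegree_C, zero_add]; exact hd i)
  refine ⟨α, ?_⟩
  ext i
  rw [sub_apply, Pi.sub_apply, delayLinear_apply, delayLinear_apply, hα, hα]
  simp [hQx, hQy]

/-- First order interpolation along an orbit segment: the parameters can be chosen such that the
`α`-linear part of the delay map has a coordinate inclusion as derivative in a local parametrization. -/
theorem exists_injective_fderiv_delayLinear {d : ℕ} (hdk : d ≤ k)
    {ψ : EuclideanSpace ℝ (Fin d) → EuclideanSpace ℝ (Fin N)} {u₀ : EuclideanSpace ℝ (Fin d)}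
    (hx : Function.Injective fun i : Fin k => T^[(i : ℕ)] (ψ u₀))
    (τ' : Fin k → EuclideanSpace ℝ (Fin d) →L[ℝ] EuclideanSpace ℝ (Fin N))
    (hτ : ∀ i : Fin k, HasFDerivAt (fun u => T^[(i : ℕ)] (ψ u)) (τ' i) u₀)
    (hτinj : ∀ i, Function.Injective (τ' i)) :
    ∃ α : Fin m → ℝ, ∃ G : EuclideanSpace ℝ (Fin d) →L[ℝ] (Fin k → ℝ),
      HasFDerivAt (fun u => delayLinear T (fun j => (b j : MvPolynomial (Fin N) ℝ)) k (ψ u) α) G u₀ ∧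
      Function.Injective G := by
  classical
  have hw : ∀ i : Fin k, ∃ w : EuclideanSpace ℝ (Fin N) →L[ℝ] ℝ, ∀ (hi : (i : ℕ) < d) v,
      w (τ' i v) = v ⟨i, hi⟩ := by
    intro i
    obtain ⟨A, hA⟩ := (τ' i : EuclideanSpace ℝ (Fin d) →ₗ[ℝ]
      EuclideanSpace ℝ (Fin N)).exists_leftInverse_of_injective
      (LinearMap.ker_eq_bot.2 (hτinj i))
    by_cases hi : (i : ℕ) < d
    · refine ⟨(EuclideanSpace.proj (𝕜 := ℝ) (⟨i, hi⟩ : Fin d)) ∘L LinearMap.toContinuousLinearMap A,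
        fun _ v => ?_⟩
      have : A (τ' i v) = v := LinearMap.congr_fun hA v
      simp [this]
    · exact ⟨0, fun h => absurd h hi⟩
  choose w hw using hw
  have hQ : ∀ i : Fin k, ∃ Q : MvPolynomial (Fin N) ℝ, Q.totalDegree ≤ 2 * k - 1 ∧
      ∀ l : Fin k, HasFDerivAt (fun x : EuclideanSpace ℝ (Fin N) =>
        MvPolynomial.eval (fun n => x n) Q) (if l = i then w i else 0) (T^[(l : ℕ)] (ψ u₀)) := by
    intro i
    obtain ⟨Q, hd, h1, h0⟩ := exists_polynomial_fderiv (T^[(i : ℕ)] (ψ u₀))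
      ((Finset.univ.erase i).image (fun l : Fin k => T^[(l : ℕ)] (ψ u₀))) (by
        simp only [Finset.mem_image, Finset.mem_erase, Finset.mem_univ, and_true, not_exists, not_and]
        exact fun l hl hli => hl (hx hli)) (w i)
    refine ⟨Q, hd.trans ?_, fun l => ?_⟩
    · have c2 := Finset.card_image_le (s := Finset.univ.erase i)
        (f := fun l : Fin k => T^[(l : ℕ)] (ψ u₀))
      rw [Finset.card_erase_of_mem (Finset.mem_univ i), Finset.card_univ, Fintype.card_fin] at c2
      have := i.pos
      omega
    · split_ifs with hl
      · rw [hl]; exact h1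
      · exact h0 _ (Finset.mem_image_of_mem _ (Finset.mem_erase.2 ⟨hl, Finset.mem_univ _⟩))
  choose Q hd hQd using hQ
  obtain ⟨α, hα⟩ := exists_coeff b (∑ i, Q i) (MvPolynomial.totalDegree_finsetSum_le fun i _ => hd i)
  refine ⟨α, ContinuousLinearMap.pi fun l => w l ∘L τ' l, ?_, ?_⟩
  · rw [hasFDerivAt_pi]
    intro l
    simp only [delayLinear_apply, hα, map_sum]
    have h1 : HasFDerivAt (fun x : EuclideanSpace ℝ (Fin N) =>
        ∑ i, MvPolynomial.eval (fun n => x n) (Q i)) (w l) (T^[(l : ℕ)] (ψ u₀)) := by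
      refine (HasFDerivAt.fun_sum fun i _ => hQd i l).congr_fderiv ?_
      simp
    exact h1.comp u₀ (hτ l)
  · intro v v' hv
    ext i
    have h1 := congrFun hv ⟨i, i.2.trans_le hdk⟩
    simp only [ContinuousLinearMap.pi_apply, ContinuousLinearMap.comp_apply] at h1
    rwa [hw _ i.2, hw _ i.2] at h1

theorem injective_fderiv_of_leftInvOn {E F : Type*} [NormedAddCommGroup E] [NormedSpace ℝ E]
    [NormedAddCommGroup F] [NormedSpace ℝ F] {V : Type*} [NormedAddCommGroup V] [NormedSpace ℝ V]
    {r : ℕ∞} (hr : 1 ≤ r) {S : F → E} {A : Set F} (hS : LocExt r S A) {τ : V → F} {τ' : V →L[ℝ] F}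
    {ψ : V → E} {ψ' : V →L[ℝ] E} {u₀ : V} (hτ : HasFDerivAt τ τ' u₀) (hψ : HasFDerivAt ψ ψ' u₀)
    (hτA : ∀ᶠ u in 𝓝 u₀, τ u ∈ A) (hSτ : ∀ᶠ u in 𝓝 u₀, S (τ u) = ψ u)
    (hinj : Function.Injective ψ') : Function.Injective τ' := by
  have hr0 : (r : WithTop ℕ∞) ≠ 0 := fun h => by simpa [h] using one_le_coe hr
  obtain ⟨O, S', hO, hxO, hS', he⟩ := hS (τ u₀) hτA.self_of_nhds
  have h1 := (((hS' _ hxO).contDiffAt (hO.mem_nhds hxO)).differentiableAt hr0).hasFDerivAt.comp u₀ hτ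
  have h2 : HasFDerivAt (S' ∘ τ) ψ' u₀ := by
    refine hψ.congr_of_eventuallyEq ?_
    filter_upwards [hτA, hSτ, hτ.continuousAt.eventually (hO.mem_nhds hxO)] with u a1 a2 a3
    rw [← a2]; exact (he ⟨a1, a3⟩).symm
  have h3 := h1.unique h2
  intro v w hvw
  refine hinj ?_
  rw [← h3]
  simp [hvw]

/-- For almost every parameter the delay map is an immersion at `x`, whence a lower Lipschitz bound
near `x`. -/
theorem ae_exists_eventually_norm_sub_le (hr : 1 ≤ r) {d : ℕ} (hM : IsEmbeddedSubmanifold r d M)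
    {S : EuclideanSpace ℝ (Fin N) → EuclideanSpace ℝ (Fin N)}
    (hT : LocExt r T M) (hTM : Set.MapsTo T M M) (hS : LocExt r S M) (hSM : Set.MapsTo S M M)
    (hST : Set.LeftInvOn S T M) (hh : LocExt r h M) (hdk : d ≤ k)
    {x : EuclideanSpace ℝ (Fin N)} (hxM : x ∈ M)
    (hx : Function.Injective fun i : Fin k => T^[(i : ℕ)] x) :
    ∀ᵐ α : Fin m → ℝ, ∃ C : ℝ, ∀ᶠ y in 𝓝[M] x, ‖x - y‖ ≤ C *
      ‖delayMap T (perturbedObservable h (fun j => (b j : MvPolynomial (Fin N) ℝ)) α) k x -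
        delayMap T (perturbedObservable h (fun j => (b j : MvPolynomial (Fin N) ℝ)) α) k y‖ := by
  have hr0 : (r : WithTop ℕ∞) ≠ 0 := fun h => by simpa [h] using one_le_coe hr
  obtain ⟨O, W, ψ, hO, hxO, hW, hψ, hψinj, hemb, him⟩ := hM x hxM
  obtain ⟨u₀, hu₀, rfl⟩ : x ∈ ψ '' W := him ▸ ⟨hxM, hxO⟩
  have hmaps : Set.MapsTo ψ W M := fun u hu =>
    ((him ▸ Set.mem_image_of_mem ψ hu : ψ u ∈ M ∩ O)).1
  have hψL : LocExt r ψ W := LocExt.of_contDiffOn hψ hW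
  have key : ∀ {F : Type} [NormedAddCommGroup F] [NormedSpace ℝ F]
      {f : EuclideanSpace ℝ (Fin N) → F}, LocExt r f M →
      HasFDerivAt (fun u => f (ψ u)) (fderiv ℝ (fun u => f (ψ u)) u₀) u₀ := by
    intro F _ _ f hf
    exact (((((hf.comp hψL hmaps).contDiffOn hW) u₀ hu₀).contDiffAt
      (hW.mem_nhds hu₀)).differentiableAt hr0).hasFDerivAt
  have hψd : HasFDerivAt ψ (fderiv ℝ ψ u₀) u₀ := key (LocExt.id M)
  have hH := key (locExt_observable_iterate (k := k) hT hTM hh)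
  have hB := key (locExt_delayLinear (k := k) (P := fun j => (b j : MvPolynomial (Fin N) ℝ)) hT hTM)
  set A := fderiv ℝ (fun u => fun i : Fin k => h (T^[(i : ℕ)] (ψ u))) u₀
  set B := fderiv ℝ (fun u => delayLinear T (fun j => (b j : MvPolynomial (Fin N) ℝ)) k (ψ u)) u₀
  have hBα : ∀ α, HasFDerivAt (fun u => delayLinear T (fun j => (b j : MvPolynomial (Fin N) ℝ)) k
      (ψ u) α) (B.flip α) u₀ := fun α => by
    refine (hB.clm_apply (hasFDerivAt_const α u₀)).congr_fderiv ?_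
    ext1 v
    simp
  obtain ⟨α₀, G, hG, hGinj⟩ := exists_injective_fderiv_delayLinear (m := m) b hdk hx
    (fun i => fderiv ℝ (fun u => T^[(i : ℕ)] (ψ u)) u₀) (fun i => key (hT.iterate hTM i)) fun i => by
      refine injective_fderiv_of_leftInvOn hr (hS.iterate hSM i) (key (hT.iterate hTM i)) hψd ?_ ?_
        (hψinj u₀ hu₀)
      · filter_upwards [hW.mem_nhds hu₀] with u hu using hTM.iterate i (hmaps hu)
      · filter_upwards [hW.mem_nhds hu₀] with u hu using iterate_leftInvOn hTM hST i (hmaps hu)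
  have hα₀ : Function.Injective (B.flip α₀) := by rwa [(hBα α₀).unique hG]
  filter_upwards [ae_injective_of_affine A B.flip α₀ hα₀] with α hα
  have hg := hH.add (hBα α)
  obtain ⟨C, hC⟩ := (hψd.isBigO_sub.trans (isBigO_sub_of_injective_fderiv hg hα)).bound
  refine ⟨|C|, ?_⟩
  obtain ⟨W₁, hW₁sub, hW₁, hu₁⟩ := mem_nhds_iff.1 (inter_mem hC (hW.mem_nhds hu₀))
  obtain ⟨O₁, hO₁, him₁⟩ := exists_isOpen_image_eq hO hemb him hW₁ fun u hu => (hW₁sub hu).2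
  have hxO₁ : ψ u₀ ∈ M ∩ O₁ := him₁ ▸ Set.mem_image_of_mem ψ hu₁
  filter_upwards [inter_mem_nhdsWithin M (hO₁.mem_nhds hxO₁.2)] with y hy
  obtain ⟨u, hu, rfl⟩ : y ∈ ψ '' W₁ := him₁ ▸ hy
  have h1 := (hW₁sub hu).1
  rw [delayMap_perturbedObservable, delayMap_perturbedObservable, norm_sub_rev (ψ u₀) (ψ u)]
  refine le_trans (h1 : ‖ψ u - ψ u₀‖ ≤ C * _) ?_
  refine mul_le_mul (le_abs_self C) ((norm_le_norm_toLp _).trans (norm_sub_rev _ _).le)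
    (norm_nonneg _) (abs_nonneg C)

/-- For almost every parameter the delay map separates `x` from all other points of `X`. -/
theorem ae_forall_eq_of_delayMap_eq (hr : 1 ≤ r)
    {S : EuclideanSpace ℝ (Fin N) → EuclideanSpace ℝ (Fin N)}
    (hT : LocExt r T M) (hTM : Set.MapsTo T M M) (hST : Set.LeftInvOn S T M) (hh : LocExt r h M)
    {X : Set (EuclideanSpace ℝ (Fin N))} (hXM : X ⊆ M) (hX : IsCompact X)
    (hH : Measure.hausdorffMeasure (k : ℝ) X = 0) {x : EuclideanSpace ℝ (Fin N)}
    (hx : Function.Injective fun i : Fin k => T^[(i : ℕ)] x) :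
    ∀ᵐ α : Fin m → ℝ, ∀ y ∈ X,
      delayMap T (perturbedObservable h (fun j => (b j : MvPolynomial (Fin N) ℝ)) α) k x =
        delayMap T (perturbedObservable h (fun j => (b j : MvPolynomial (Fin N) ℝ)) α) k y →
      x = y := by
  classical
  set P : Fin m → MvPolynomial (Fin N) ℝ := fun j => (b j : MvPolynomial (Fin N) ℝ)
  let a : EuclideanSpace ℝ (Fin N) → Fin k → ℝ := fun y =>
    (fun i : Fin k => h (T^[(i : ℕ)] x)) - fun i : Fin k => h (T^[(i : ℕ)] y)
  let B : EuclideanSpace ℝ (Fin N) → (Fin m → ℝ) →L[ℝ] (Fin k → ℝ) := fun y =>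
    delayLinear T P k x - delayLinear T P k y
  have heq : ∀ α y, delayMap T (perturbedObservable h P α) k x =
      delayMap T (perturbedObservable h P α) k y → a y + B y α = 0 := by
    intro α y hy
    rw [delayMap_perturbedObservable, delayMap_perturbedObservable] at hy
    have h1 := WithLp.toLp_injective 2 hy
    simp only [a, B, sub_apply]
    rw [sub_add_sub_comm, h1, sub_self]
  have ha : LocExt 1 a X := by
    refine LocExt.of_le (LocExt.mono ?_ hXM) hr
    exact LocExt.contDiff_comp (h := fun c => (fun i : Fin k => h (T^[(i : ℕ)] x)) - c)
      (contDiff_const.sub contDiff_id) (locExt_observable_iterate hT hTM hh)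
  have hB : LocExt 1 B X := by
    refine LocExt.of_le (LocExt.mono ?_ hXM) hr
    exact LocExt.contDiff_comp (h := fun c => delayLinear T P k x - c)
      (contDiff_const.sub contDiff_id) (locExt_delayLinear hT hTM)
  -- The points whose orbit segment meets that of `x`, where the rank of `B y` may drop.
  let J : Set (EuclideanSpace ℝ (Fin N)) := {y | ∃ i j : Fin k, T^[(i : ℕ)] x = T^[(j : ℕ)] y}
  have hJ : (X ∩ J).Finite := by
    refine (Set.finite_range fun p : Fin k × Fin k => S^[(p.2 : ℕ)] (T^[(p.1 : ℕ)] x)).subset ?_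
    rintro y ⟨hyX, i, j, hij⟩
    exact ⟨(i, j), by simp only [hij]; exact iterate_leftInvOn hTM hST j (hXM hyX)⟩
  have hnear : ∀ y ∈ X \ J, ∃ U ∈ 𝓝 y, volume {α | ∃ z ∈ X ∩ U, a z + B z α = 0} = 0 := by
    intro y hy
    refine exists_nhds_volume_solvable_eq_zero hX hH ha hB hy.1
      (surjective_delayLinear_sub b hx fun i j hij => hy.2 ⟨i, j, hij⟩)
  choose! U hU hUnull using hnear
  obtain ⟨t, htsub, htc, hcov⟩ := TopologicalSpace.countable_cover_nhdsWithin (f := U)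
    fun y hy => mem_nhdsWithin_of_mem_nhds (hU y hy)
  have hpoint : ∀ y ∈ (X ∩ J) \ {x}, volume {α | a y + B y α = 0} = 0 := by
    rintro y ⟨⟨-, i, -, -⟩, hyx⟩
    have hk : 0 < k := i.pos
    obtain ⟨Q, hd, h1, h0⟩ := exists_polynomial_separating x {y}
      (by simpa using fun hxy : x = y => hyx hxy.symm)
    obtain ⟨α₀, hα₀⟩ := exists_coeff b Q (hd.trans (by rw [Finset.card_singleton]; omega))
    have hBα₀ : B y α₀ ⟨0, hk⟩ = 1 := by
      simp only [B, P, sub_apply, Pi.sub_apply, delayLinear_apply, hα₀, Function.iterate_zero, id]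
      rw [h1, h0 y (by simp), sub_zero]
    have hclosed : IsClosed {α | a y + B y α = 0} :=
      isClosed_eq (by fun_prop) continuous_const
    refine volume_eq_zero_of_slices (volume : Measure ℝ) (ContinuousLinearMap.toSpanSingleton ℝ α₀)
      hclosed.measurableSet fun α => ?_
    refine measure_mono_null (t := {-(a y ⟨0, hk⟩ + B y α ⟨0, hk⟩)}) ?_ (by simp)
    intro s hs
    have h2 := congrFun (hs : a y + B y (α + s • α₀) = 0) ⟨0, hk⟩
    simp only [ContinuousLinearMap.toSpanSingleton_apply, map_add, map_smul, Pi.add_apply, Pi.smul_apply,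
      hBα₀, smul_eq_mul, mul_one, Pi.zero_apply] at h2
    rw [Set.mem_singleton_iff]
    linarith
  have hall : ∀ᵐ α : Fin m → ℝ, (∀ y ∈ (X ∩ J) \ {x}, ¬ (a y + B y α = 0)) ∧
      ∀ y ∈ t, ¬ ∃ z ∈ X ∩ U y, a z + B z α = 0 := by
    refine Filter.Eventually.and ?_ ?_
    · refine (ae_ball_iff (hJ.subset Set.sdiff_subset).countable).2 fun y hy => ?_
      rw [ae_iff]; simpa using hpoint y hy
    · refine (ae_ball_iff htc).2 fun y hy => ?_
      rw [ae_iff]; simpa only [not_not] using hUnull y (htsub hy)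
  filter_upwards [hall] with α hα y hy hxy
  by_contra hne
  by_cases hyJ : y ∈ J
  · exact hα.1 y ⟨⟨hy, hyJ⟩, fun h => hne h.symm⟩ (heq α y hxy)
  · obtain ⟨z, hz, hyz⟩ := Set.mem_iUnion₂.1 (hcov ⟨hy, hyJ⟩)
    exact hα.2 z hz ⟨y, ⟨hy, hyz⟩, heq α y hxy⟩

end FixedPoint

/-! ### Almost every parameter and almost every point -/

theorem LocExt.delayMap (hT : LocExt r T M) (hTM : Set.MapsTo T M M) (hh : LocExt r h M)
    (α : Fin m → ℝ) : LocExt r (delayMap T (perturbedObservable h P α) k) M := by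
  have h1 : LocExt r (fun y => (WithLp.toLp 2 ((fun i : Fin k => h (T^[(i : ℕ)] y)) +
      delayLinear T P k y α) : EuclideanSpace ℝ (Fin k))) M :=
    LocExt.contDiff_comp (h := fun c : (Fin k → ℝ) × ((Fin m → ℝ) →L[ℝ] (Fin k → ℝ)) =>
        (WithLp.toLp 2 (c.1 + c.2 α) : EuclideanSpace ℝ (Fin k)))
      ((PiLp.continuousLinearEquiv 2 ℝ fun _ : Fin k => ℝ).symm.contDiff.comp
        (contDiff_fst.add (contDiff_snd.clm_apply contDiff_const)))
      ((locExt_observable_iterate hT hTM hh).prodMk (locExt_delayLinear hT hTM))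
  convert h1 using 1
  ext1 y
  exact delayMap_perturbedObservable y α

/-- The parameters and points for which a lower Lipschitz bound holds form a set of type `F_σ`. -/
theorem measurableSet_exists_norm_sub_le (hT : LocExt r T M) (hTM : Set.MapsTo T M M)
    (hh : LocExt r h M) {X : Set (EuclideanSpace ℝ (Fin N))} (hXM : X ⊆ M) (hX : IsClosed X) :
    MeasurableSet {p : (Fin m → ℝ) × EuclideanSpace ℝ (Fin N) | p.2 ∈ X ∧
      ∃ C : ℝ, 0 ≤ C ∧ ∀ y ∈ X, ‖p.2 - y‖ ≤ C *
        ‖delayMap T (perturbedObservable h P p.1) k p.2 -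
          delayMap T (perturbedObservable h P p.1) k y‖} := by
  have hcl : IsClosed (Set.univ ×ˢ X : Set ((Fin m → ℝ) × EuclideanSpace ℝ (Fin N))) :=
    isClosed_univ.prod hX
  have hcont : ContinuousOn (fun p : (Fin m → ℝ) × EuclideanSpace ℝ (Fin N) =>
      delayMap T (perturbedObservable h P p.1) k p.2) (Set.univ ×ˢ X) := by
    simp only [delayMap_perturbedObservable]
    refine (PiLp.continuous_toLp 2 _).comp_continuousOn ?_
    refine ContinuousOn.add ?_ (ContinuousOn.clm_apply ?_ continuousOn_fst)
    · exact ((locExt_observable_iterate hT hTM hh).continuousOn.mono hXM).comp continuousOn_snd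
        fun p hp => hp.2
    · exact ((locExt_delayLinear hT hTM).continuousOn.mono hXM).comp continuousOn_snd
        fun p hp => hp.2
  have hset : {p : (Fin m → ℝ) × EuclideanSpace ℝ (Fin N) | p.2 ∈ X ∧
      ∃ C : ℝ, 0 ≤ C ∧ ∀ y ∈ X, ‖p.2 - y‖ ≤ C *
        ‖delayMap T (perturbedObservable h P p.1) k p.2 -
          delayMap T (perturbedObservable h P p.1) k y‖} =
      ⋃ n : ℕ, (Set.univ ×ˢ X) ∩ ⋂ y ∈ X, {p ∈ Set.univ ×ˢ X | ‖p.2 - y‖ ≤ n *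
        ‖delayMap T (perturbedObservable h P p.1) k p.2 -
          delayMap T (perturbedObservable h P p.1) k y‖} := by
    ext p
    simp only [Set.mem_iUnion, Set.mem_inter_iff, Set.mem_iInter]
    constructor
    · rintro ⟨hp, C, hC0, hC⟩
      obtain ⟨n, hn⟩ := exists_nat_ge C
      refine ⟨n, ⟨trivial, hp⟩, fun y hy => ⟨⟨trivial, hp⟩, (hC y hy).trans ?_⟩⟩
      gcongr
    · rintro ⟨n, hp, hn⟩
      exact ⟨hp.2, n, n.cast_nonneg, fun y hy => (hn y hy).2⟩
  rw [hset]
  refine MeasurableSet.iUnion fun n => (hcl.inter (isClosed_biInter fun y hy => ?_)).measurableSet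
  refine hcl.isClosed_le (by fun_prop) (continuousOn_const.mul (hcont.sub ?_).norm)
  exact hcont.comp (f := fun p : (Fin m → ℝ) × EuclideanSpace ℝ (Fin N) => (p.1, y))
    (by fun_prop) fun p _ => ⟨trivial, hy⟩

/-- The lower Lipschitz bound for almost every parameter and almost every point. -/
theorem ae_ae_exists_norm_sub_le
    (b : Module.Basis (Fin m) ℝ (MvPolynomial.restrictTotalDegree (Fin N) ℝ (2 * k - 1)))
    (hr : 1 ≤ r) {d : ℕ} (hM : IsEmbeddedSubmanifold r d M)
    {S : EuclideanSpace ℝ (Fin N) → EuclideanSpace ℝ (Fin N)}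
    (hT : LocExt r T M) (hTM : Set.MapsTo T M M) (hS : LocExt r S M) (hSM : Set.MapsTo S M M)
    (hST : Set.LeftInvOn S T M) (hh : LocExt r h M) (hdk : d ≤ k)
    {X : Set (EuclideanSpace ℝ (Fin N))} (hXM : X ⊆ M) (hX : IsCompact X)
    (hH : Measure.hausdorffMeasure (k : ℝ) X = 0)
    (μ : Measure (EuclideanSpace ℝ (Fin N))) [IsProbabilityMeasure μ] (hμX : μ Xᶜ = 0)
    (hper : μ (⋃ j ∈ Finset.Icc 1 (k - 1), {x | x ∈ M ∧ T^[j] x = x}) = 0) :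
    ∀ᵐ α : Fin m → ℝ, ∀ᵐ x ∂μ, x ∈ X ∧ ∃ C : ℝ, 0 ≤ C ∧ ∀ y ∈ X, ‖x - y‖ ≤ C *
      ‖delayMap T (perturbedObservable h (fun j => (b j : MvPolynomial (Fin N) ℝ)) α) k x -
        delayMap T (perturbedObservable h (fun j => (b j : MvPolynomial (Fin N) ℝ)) α) k y‖ := by
  rw [Measure.ae_ae_comm (measurableSet_exists_norm_sub_le hT hTM hh hXM hX.isClosed)]
  have hXae : ∀ᵐ x ∂μ, x ∈ X := hμX
  have hperae : ∀ᵐ x ∂μ, x ∉ ⋃ j ∈ Finset.Icc 1 (k - 1), {x | x ∈ M ∧ T^[j] x = x} := by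
    rw [ae_iff]; simp only [not_not]
    exact hper
  filter_upwards [hXae, hperae] with x hxX hxper
  have hx : Function.Injective fun i : Fin k => T^[(i : ℕ)] x := by
    have hlt : ∀ i j : Fin k, i < j → T^[(i : ℕ)] x ≠ T^[(j : ℕ)] x := by
      intro i j hij h1
      refine hxper (Set.mem_iUnion₂.2 ⟨j - i, ?_, hXM hxX, ?_⟩)
      · rw [Finset.mem_Icc]
        have := j.2
        have : (i : ℕ) < j := hij
        omega
      · have h2 : T^[(j : ℕ)] x = T^[(i : ℕ)] (T^[(j : ℕ) - i] x) := by
          rw [← Function.iterate_add_apply, Nat.add_sub_cancel' (le_of_lt hij)]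
        rw [h2] at h1
        have h3 := congrArg S^[(i : ℕ)] h1
        rw [iterate_leftInvOn hTM hST i (hXM hxX),
          iterate_leftInvOn hTM hST i (hTM.iterate _ (hXM hxX))] at h3
        exact h3.symm
    intro i j hij
    rcases lt_trichotomy i j with h1 | h1 | h1
    · exact absurd hij (hlt i j h1)
    · exact h1
    · exact absurd hij.symm (hlt j i h1)
  filter_upwards [ae_forall_eq_of_delayMap_eq b hr hT hTM hST hh hXM hX hH hx,
    ae_exists_eventually_norm_sub_le b hr hM hT hTM hS hSM hST hh hdk (hXM hxX) hx] with α h1 h2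
  obtain ⟨C, hC⟩ := h2
  exact ⟨hxX, exists_norm_sub_le_of_eventually hX ((LocExt.delayMap hT hTM hh α).continuousOn.mono hXM)
    h1 (nhdsWithin_mono x hXM hC)⟩

end Dynamics

end Takens

theorem theorem4p1 (r : ℕ∞) (hr : 1 ≤ r) (N d : ℕ)
    (M : Set (EuclideanSpace ℝ (Fin N))) (hMc : IsCompact M)
    (hM : Takens.IsEmbeddedSubmanifold r d M)
    (T : EuclideanSpace ℝ (Fin N) → EuclideanSpace ℝ (Fin N))
    (hT : Takens.IsCrDiffeo r T M M)
    (X : Set (EuclideanSpace ℝ (Fin N))) (hXM : X ⊆ M) (hXc : IsCompact X)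
    (μ : Measure (EuclideanSpace ℝ (Fin N))) [IsProbabilityMeasure μ] (hμX : μ Xᶜ = 0)
    (k : ℕ)
    (hper : μ (⋃ j ∈ Finset.Icc 1 (k - 1), {x | x ∈ M ∧ T^[j] x = x}) = 0)
    (m : ℕ)
    (b : Module.Basis (Fin m) ℝ (MvPolynomial.restrictTotalDegree (Fin N) ℝ (2 * k - 1)))
    (h : EuclideanSpace ℝ (Fin N) → ℝ) (hh : Takens.IsCrFunOn r h M)
    (φ : (Fin m → ℝ) → EuclideanSpace ℝ (Fin N) → EuclideanSpace ℝ (Fin k))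
    (hφ : φ = fun α => Takens.delayMap T
      (Takens.perturbedObservable h (fun j => (b j : MvPolynomial (Fin N) ℝ)) α) k) :
    ∀ᵐ α : Fin m → ℝ,
      (Measure.hausdorffMeasure (k : ℝ) X = 0 → d ≤ k →
        ∀ᵐ x ∂μ, ∃ C : ℝ, 0 ≤ C ∧ ∀ y ∈ X, ‖x - y‖ ≤ C * ‖φ α x - φ α y‖) ∧
      (d < k →
        ∀ᵐ x ∂μ, ∃ (U : Set (EuclideanSpace ℝ (Fin N))) (V : Set (EuclideanSpace ℝ (Fin k))),
          (∃ O : Set (EuclideanSpace ℝ (Fin N)), IsOpen O ∧ U = M ∩ O) ∧ x ∈ U ∧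
          IsOpen V ∧ φ α x ∈ V ∧
          U = M ∩ φ α ⁻¹' V ∧
          Takens.IsEmbeddedSubmanifold r d (V ∩ φ α '' M) ∧
          Takens.IsCrDiffeo r (φ α) U (V ∩ φ α '' M)) := by
  obtain ⟨hbij, hTr, S, hinv, hSr⟩ := hT
  have hTL : Takens.LocExt r T M := hTr
  have hSL : Takens.LocExt r S M := hSr
  have hhL : Takens.LocExt r h M := hh
  have hTM : Set.MapsTo T M M := hbij.mapsTo
  have hSM : Set.MapsTo S M M := hinv.1.mapsTo hbij.surjOn
  subst hφ
  refine Filter.Eventually.and ?_ ?_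
  · by_cases hcase : Measure.hausdorffMeasure (k : ℝ) X = 0 ∧ d ≤ k
    · filter_upwards [Takens.ae_ae_exists_norm_sub_le b hr hM hTL hTM hSL hSM hinv.1 hhL hcase.2 hXM
        hXc hcase.1 μ hμX hper] with α hα _ _
      exact hα.mono fun x hx => hx.2
    · exact Filter.Eventually.of_forall fun α h1 h2 => absurd ⟨h1, h2⟩ hcase
  · by_cases hdk : d < k
    -- Here `M` is `H^k`-null, so the bound holds with `X` replaced by `M`.
    · have hμM : μ Mᶜ = 0 := measure_mono_null (Set.compl_subset_compl.2 hXM) hμX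
      filter_upwards [Takens.ae_ae_exists_norm_sub_le b hr hM hTL hTM hSL hSM hinv.1 hhL hdk.le
        subset_rfl hMc (hM.hausdorffMeasure_eq_zero hr hdk) μ hμM hper] with α hα _
      filter_upwards [hα] with x hx
      obtain ⟨hxM, C, -, hC⟩ := hx
      exact Takens.exists_embedded_neighbourhood hr hMc hM (hTL.delayMap hTM hhL α) hxM hC
    · exact Filter.Eventually.of_forall fun α h1 => absurd h1 hdk
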